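/- **Conventions.** Let $\mathbb K\in\{\mathbb R,\mathbb C\}$. For a locally convex Hausdorff space $X$ let $X'$ be its topological dual, $X_b'$ the dual with the topology of uniform convergence on bounded sets, and call $X$ *bornological* if every absolutely convex set absorbing all bounded sets is a $0$-neighbourhood, *semi-reflexive* if the evaluation map $X\to (X_b')'$ is surjective, and *semi-Montel* if every bounded subset of $X$ is relatively compact. For topologies, $\tau_0\le\tau_1$ means that $\tau_0$ is coarser than $\tau_1$. Topological isomorphisms are linear homeomorphisms. Let $\tau,\widetilde\tau$ be locally convex Hausdorff topologies on a $\mathbb K$-vector space $X$, and $\mathcal B$ the family of $\tau$-bounded sets. We say that $(X,\tau)$ satisfies, for $\widetilde\tau$, * (BBC) if every $\tau$-bounded set is contained in an absolutely convex $\tau$-bounded $\widetilde\tau$-compact set; * (BBCl) if every $\tau$-bounded set is contained in an absolutely convex $\tau$-bounded $\widetilde\tau$-closed set; * (CNC) if $\tau$ has a $0$-neighbourhood basis of absolutely convex $\widetilde\tau$-closed sets. Let $\widetilde\gamma=\widetilde\gamma(\tau,\widetilde\tau)$ be the finest locally convex Hausdorff topology on $X$ which coincides with $\widetilde\tau$ on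 all $\tau$-bounded sets; $(X,\widetilde\gamma)$ satisfies (B$\tau$B$\widetilde\gamma$) if a subset of $X$ is $\tau$-bounded if and only if it is $\widetilde\gamma$-bounded. Let $X'_{\mathcal B,\widetilde\tau}$ be the space of all linear functionals $X\to\mathbb K$ whose restriction to every $B\in\mathcal B$ is $\widetilde\tau$-continuous. **Theorem.** Let $(\mathcal F,\tau)$ be a bornological locally convex Hausdorff space of $\mathbb K$-valued functions on a non-empty set $\Omega$ (a linear subspace $\mathcal F$ of $\mathbb K^\Omega$ with a bornological locally convex Hausdorff topology $\tau$), $\mathcal B$ the family of $\tau$-bounded sets, $\tau_{\mathrm p}$ the topology of pointwise convergence on $\mathcal F$, and $\delta_x(f):=f(x)$ for $f\in\mathcal F$, $x\in\Omega$. In the following, $\widetilde\tau$ always denotes a locally convex Hausdorff topology on $\mathcal F$. The following assertions are equivalent. (a) $(\mathcal F,\tau)$ admits a strong complete barrelled linearisation, i.e. there are a complete barrelled locally convex Hausdorff space $Y$ over $\mathbb K$, a map $\delta\colon\Omega\to Y$ and a topological isomorphism $T\colon(\mathcal F,\tau)\to Y_b'$ such that $T(f)\circ\delta=f$ for all $f\in\mathcal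 F$. (b) There are a semi-Montel locally convex Hausdorff space $Y$ over $\mathbb K$ such that $Y_b'$ is complete and a topological isomorphism $\varphi\colon(\mathcal F,\tau)\to(Y_b')_b'$ such that for every $x\in\Omega$ there is a unique $y_x'\in Y'$ with $\delta_x=\varphi(\cdot)(y_x')$. (c) $(\mathcal F,\tau)$ satisfies (BBC) and (CNC) for some $\widetilde\tau$ such that $\tau_{\mathrm p}\le\widetilde\tau$ and $(\mathcal F,\widetilde\gamma)$ satisfies (B$\tau$B$\widetilde\gamma$). (d) $(\mathcal F,\tau)$ satisfies (BBCl) and (CNC) for some $\widetilde\tau$ such that $\tau_{\mathrm p}\le\widetilde\tau$ and $(\mathcal F,\widetilde\gamma)$ is semi-reflexive and satisfies (B$\tau$B$\widetilde\gamma$). (e) $(\mathcal F,\tau)$ satisfies (BBC) and (CNC) for some $\widetilde\tau$ such that $\tau_{\mathrm p}\le\widetilde\tau$. (f) $(\mathcal F,\tau)$ satisfies (BBC) and (CNC) for some $\widetilde\tau$ such that $\delta_x\in\mathcal F'_{\mathcal B,\widetilde\tau}$ for all $x\in\Omega$. -/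

import Mathlib

open scoped ComplexOrder Topology

universe u v w

namespace LCLin

section Spaces

variable (𝕜 : Type v) [RCLike 𝕜] {X : Type*} [AddCommGroup X] [Module 𝕜 X]

/-- `τ` is a locally convex Hausdorff topology on the `𝕜`-vector space `X`. -/
structure IsLCHausdorff (τ : TopologicalSpace X) : Prop where
  isTopologicalAddGroup : @IsTopologicalAddGroup X τ _
  continuousSMul : @ContinuousSMul 𝕜 X _ _ τ
  locallyConvexSpace : @LocallyConvexSpace 𝕜 X _ _ _ _ τ
  t2Space : @T2Space X τ

/-- `B` is `τ`-bounded. -/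
abbrev IsBdd (τ : TopologicalSpace X) (B : Set X) : Prop :=
  @Bornology.IsVonNBounded 𝕜 X _ _ _ τ B

/-- `(X, τ)` is bornological: every absolutely convex set which absorbs all `τ`-bounded sets is
a `τ`-neighbourhood of zero. -/
def IsBornological (τ : TopologicalSpace X) : Prop :=
  ∀ U : Set X, AbsConvex 𝕜 U → (∀ B, IsBdd 𝕜 τ B → Absorbs 𝕜 U B) → U ∈ @nhds X τ 0

/-- `(X, τ)` is semi-reflexive: every continuous linear functional on the strong dual of `(X, τ)`
is the evaluation at a point of `X`. -/
def IsSemiReflexive (τ : TopologicalSpace X) : Prop :=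
  ∀ u : StrongDual 𝕜 (StrongDual 𝕜 X), ∃ x : X, ∀ x' : StrongDual 𝕜 X, u x' = x' x

/-- (BBC) for `τt`: every `τ`-bounded set is contained in an absolutely convex `τ`-bounded
`τt`-compact set. -/
def BBC (τ τt : TopologicalSpace X) : Prop :=
  ∀ B, IsBdd 𝕜 τ B → ∃ C, B ⊆ C ∧ AbsConvex 𝕜 C ∧ IsBdd 𝕜 τ C ∧ @IsCompact X τt C

/-- (BBCl) for `τt`: every `τ`-bounded set is contained in an absolutely convex `τ`-bounded
`τt`-closed set. -/
def BBCl (τ τt : TopologicalSpace X) : Prop :=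
  ∀ B, IsBdd 𝕜 τ B → ∃ C, B ⊆ C ∧ AbsConvex 𝕜 C ∧ IsBdd 𝕜 τ C ∧ IsClosed[τt] C

/-- (CNC) for `τt`: `τ` has a basis of neighbourhoods of zero consisting of absolutely convex
`τt`-closed sets. -/
def CNC (τ τt : TopologicalSpace X) : Prop :=
  ∃ U₀ : Set (Set X), (∀ U ∈ U₀, AbsConvex 𝕜 U ∧ IsClosed[τt] U) ∧
    (@nhds X τ 0).HasBasis (fun U => U ∈ U₀) id

/-- The locally convex Hausdorff topologies on `X` which coincide with `τt` on all `τ`-bounded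
sets. -/
def mixedTopologies (τ τt : TopologicalSpace X) : Set (TopologicalSpace X) :=
  {σ | IsLCHausdorff 𝕜 σ ∧ ∀ B, IsBdd 𝕜 τ B →
    TopologicalSpace.induced ((↑) : B → X) σ = TopologicalSpace.induced ((↑) : B → X) τt}

/-- The finest locally convex Hausdorff topology on `X` which coincides with `τt` on all
`τ`-bounded sets (in the order of `TopologicalSpace X`, finer means smaller); that it is a member
of `mixedTopologies` is `isLeast_gammaTilde`. -/
@[reducible] def gammaTilde (τ τt : TopologicalSpace X) : TopologicalSpace X :=
  sInf (mixedTopologies 𝕜 τ τt)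

theorem isLeast_gammaTilde (τ τt : TopologicalSpace X) (h : IsLCHausdorff 𝕜 τt) :
    IsLeast (mixedTopologies 𝕜 τ τt) (gammaTilde 𝕜 τ τt) := by
  have hmem : τt ∈ mixedTopologies 𝕜 τ τt := ⟨h, fun _ _ => rfl⟩
  refine ⟨⟨⟨?_, ?_, ?_, ?_⟩, ?_⟩, fun σ hσ => sInf_le hσ⟩
  · exact topologicalAddGroup_sInf fun σ hσ => hσ.1.isTopologicalAddGroup
  · exact continuousSMul_sInf fun σ hσ => hσ.1.continuousSMul
  · have : ∀ σ ∈ mixedTopologies 𝕜 τ τt, @IsTopologicalAddGroup X σ _ :=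
      fun σ hσ => hσ.1.isTopologicalAddGroup
    exact LocallyConvexSpace.sInf fun σ hσ => hσ.1.locallyConvexSpace
  · exact t2Space_antitone (sInf_le hmem) h.t2Space
  · intro B hB
    apply le_antisymm
    · exact induced_mono (sInf_le hmem)
    · rw [gammaTilde, sInf_eq_iInf, induced_iInf]
      refine le_iInf fun σ => ?_
      rw [induced_iInf]
      exact le_iInf fun hσ => (hσ.2 B hB).ge

/-- (BτBγ): the `τ`-bounded sets are exactly the `γ`-bounded sets. -/
def SameBounded (τ γ : TopologicalSpace X) : Prop :=
  ∀ B : Set X, IsBdd 𝕜 τ B ↔ IsBdd 𝕜 γ B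

/-- The space of linear functionals on `X` whose restriction to every `τ`-bounded set is
`τt`-continuous. -/
def boundedDual (τ τt : TopologicalSpace X) : Submodule 𝕜 (Module.Dual 𝕜 X) where
  carrier := {u | ∀ B, IsBdd 𝕜 τ B → @ContinuousOn X 𝕜 τt _ u B}
  add_mem' hu hv B hB := by
    let _ : TopologicalSpace X := τt
    exact ContinuousOn.add (hu B hB) (hv B hB)
  zero_mem' B _ := by
    let _ : TopologicalSpace X := τt
    exact continuousOn_const
  smul_mem' c u hu B hB := by
    let _ : TopologicalSpace X := τt
    exact ContinuousOn.const_smul (hu B hB) c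

end Spaces

section FunctionSpaces

variable {𝕜 : Type v} [RCLike 𝕜] {Ω : Type u}

/-- The topology of pointwise convergence on a space of functions. -/
@[reducible] def pointwiseTopology (F : Submodule 𝕜 (Ω → 𝕜)) : TopologicalSpace F :=
  TopologicalSpace.induced (fun f => (f : Ω → 𝕜)) Pi.topologicalSpace

/-- The point evaluation `δ_x`. -/
def pointEval (F : Submodule 𝕜 (Ω → 𝕜)) (x : Ω) : Module.Dual 𝕜 F :=
  (LinearMap.proj x).comp F.subtype

/-- `(δ, Y, T)` is a strong linearisation of `(F, τ)`: the linear bijection `T` is a topological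
isomorphism onto the strong dual of `Y`, and `T(f) ∘ δ = f` for all `f ∈ F`. -/
def IsStrongLinearisation (F : Submodule 𝕜 (Ω → 𝕜)) (τ : TopologicalSpace F)
    {Y : Type*} [AddCommGroup Y] [Module 𝕜 Y] [TopologicalSpace Y]
    (δ : Ω → Y) (T : F ≃ₗ[𝕜] StrongDual 𝕜 Y) : Prop :=
  @IsHomeomorph F (StrongDual 𝕜 Y) τ _ T ∧ ∀ f : F, (T f : Y → 𝕜) ∘ δ = (f : Ω → 𝕜)

/-- `(F, τ)` admits a strong linearisation `(δ, Y, T)` with a complete barrelled locally convex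
Hausdorff space `Y`. The universe `w` is arbitrary. -/
def AdmitsStrongCompleteBarrelledLinearisation (F : Submodule 𝕜 (Ω → 𝕜))
    (τ : TopologicalSpace F) : Prop :=
  ∃ (Y : Type (max u v w)) (_ : AddCommGroup Y) (_ : Module 𝕜 Y) (uY : UniformSpace Y)
    (_ : IsUniformAddGroup Y),
    IsLCHausdorff 𝕜 uY.toTopologicalSpace ∧ CompleteSpace Y ∧ BarrelledSpace 𝕜 Y ∧
    ∃ (δ : Ω → Y) (T : F ≃ₗ[𝕜] StrongDual 𝕜 Y), IsStrongLinearisation F τ δ T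

/-- `(F, τ)` has a semi-Montel prebidual `(Y, φ)` with complete strong dual `Y'`, such that every
point evaluation is of the form `f ↦ φ(f)(y')` for a unique `y' ∈ Y'`. Mathlib's `MontelSpace` does
not include barrelledness, so it is the notion of a semi-Montel space. The universe `w` is
arbitrary. -/
def HasSemiMontelPrebidualWithEvaluations (F : Submodule 𝕜 (Ω → 𝕜))
    (τ : TopologicalSpace F) : Prop :=
  ∃ (Y : Type (max u v w)) (_ : AddCommGroup Y) (_ : Module 𝕜 Y) (tY : TopologicalSpace Y),
    IsLCHausdorff 𝕜 tY ∧ MontelSpace 𝕜 Y ∧ CompleteSpace (StrongDual 𝕜 Y) ∧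
    ∃ φ : F ≃ₗ[𝕜] StrongDual 𝕜 (StrongDual 𝕜 Y),
      @IsHomeomorph F (StrongDual 𝕜 (StrongDual 𝕜 Y)) τ _ φ ∧
      ∀ x : Ω, ∃! y' : StrongDual 𝕜 Y, ∀ f : F, pointEval F x f = φ f y'

end FunctionSpaces

end LCLin

/-!
The space `Y` with strong dual `(F, τ)` is the strong dual of `(F, γ̃)`. (BBC) makes `(F, γ̃)`
semi-Montel, hence semi-reflexive, so its strong dual is barrelled; this dual is complete because
a functional which is `γ̃`-continuous on bounded sets is `γ̃`-continuous. The polars of `γ̃`-bounded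
sets then induce `τ` on the bidual: one inclusion of neighbourhood filters is bornologicity, the
other is the bipolar theorem applied to the closed neighbourhoods provided by (CNC).

That `γ̃` has no more bounded sets than `τ` follows from uniform boundedness on `ℓ¹`. If `U` is a
`τ`-neighbourhood of zero which is closed for the coarser topology, an absolutely summable series
of functionals from the polar of `U` converges uniformly on `τ`-bounded sets, hence is
`γ̃`-continuous, so that it is bounded on each `γ̃`-bounded set `B`. Since this holds for all
coefficients in `ℓ¹`, the functionals in the polar of `U` are uniformly bounded on `B`, and `U`
absorbs `B`.

Conversely, the weak* topology on the strong dual of a barrelled space satisfies (BBC) by the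
theorems of Banach–Steinhaus and Alaoglu, and (CNC) because polars are weak*-closed.
-/

namespace LCLin

open Bornology (IsVonNBounded)
open Topology (IsEmbedding IsInducing)

section Polars

variable {𝕜 E V : Type*} [NontriviallyNormedField 𝕜] [AddCommGroup E] [Module 𝕜 E]
  [AddCommGroup V] [Module 𝕜 V] (p : E →ₗ[𝕜] V →ₗ[𝕜] 𝕜)

theorem absorbs_polar_iff {s : Set E} {t : Set V} :
    Absorbs 𝕜 (p.polar s) t ↔ ∃ r : ℝ, ∀ x ∈ s, ∀ y ∈ t, ‖p x y‖ ≤ r := by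
  constructor
  · intro h
    obtain ⟨c, hc⟩ := h.exists
    refine ⟨‖c‖, fun x hx y hy => ?_⟩
    obtain ⟨z, hz, rfl⟩ := hc hy
    simpa using mul_le_mul_of_nonneg_left (hz x hx) (norm_nonneg c)
  · rintro ⟨r, hr⟩
    refine Absorbs.of_norm ⟨max r 1, fun c hc y hy => ?_⟩
    have hc0 : 0 < ‖c‖ := zero_lt_one.trans_le ((le_max_right _ _).trans hc)
    rw [Set.mem_smul_set_iff_inv_smul_mem₀ (norm_pos_iff.1 hc0)]
    intro x hx
    rw [map_smul, norm_smul, norm_inv, inv_mul_le_iff₀ hc0, mul_one]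
    exact (hr x hx y hy).trans ((le_max_left _ _).trans hc)

theorem absorbs_polar_comm {s : Set E} {t : Set V} :
    Absorbs 𝕜 (p.polar s) t ↔ Absorbs 𝕜 (p.flip.polar t) s := by
  simp only [absorbs_polar_iff, LinearMap.flip_apply]
  exact exists_congr fun r => forall₂_comm

theorem exists_forall_mem_polar_norm_le_of_absorbs {s t : Set E} (h : Absorbs 𝕜 s t) :
    ∃ r : ℝ, ∀ y ∈ p.polar s, ∀ x ∈ t, ‖p x y‖ ≤ r :=
  (absorbs_polar_iff p.flip).1 (h.mono_left (p.subset_bipolar s))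

end Polars

theorem locallyConvexSpace_iff_real {𝕜 E : Type*} [RCLike 𝕜] [AddCommGroup E] [Module 𝕜 E]
    [Module ℝ E] [IsScalarTower ℝ 𝕜 E] [TopologicalSpace E] :
    LocallyConvexSpace 𝕜 E ↔ LocallyConvexSpace ℝ E := by
  simp only [locallyConvexSpace_iff, convex_RCLike_iff_convex_real (K := 𝕜)]

instance locallyConvexSpace_self {𝕜 : Type*} [RCLike 𝕜] : LocallyConvexSpace 𝕜 𝕜 :=
  locallyConvexSpace_iff_real.2 inferInstance

section StrongDualPolar

variable {𝕜 X : Type*} [NontriviallyNormedField 𝕜] [AddCommGroup X] [Module 𝕜 X]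
  [TopologicalSpace X]

theorem isClosed_polar_topDualPairing (M : Set (StrongDual 𝕜 X)) :
    IsClosed ((topDualPairing 𝕜 X).polar M) := by
  rw [LinearMap.polar_eq_iInter]
  exact isClosed_biInter fun f _ => isClosed_le f.continuous.norm continuous_const

end StrongDualPolar

section Bipolar

variable {𝕜 X : Type*} [RCLike 𝕜] [AddCommGroup X] [Module 𝕜 X] [TopologicalSpace X]
  [IsTopologicalAddGroup X] [ContinuousSMul 𝕜 X] [LocallyConvexSpace 𝕜 X]

theorem exists_mem_strongDualPolar_one_lt_norm {C : Set X} (hC : AbsConvex 𝕜 C)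
    (hcl : IsClosed C) (hne : C.Nonempty) {x : X} (hx : x ∉ C) :
    ∃ f ∈ StrongDual.polar 𝕜 C, 1 < ‖f x‖ := by
  let _ : Module ℝ X := .restrictScalars ℝ 𝕜 X
  have : IsScalarTower ℝ 𝕜 X := .restrictScalars ℝ 𝕜 X
  have : LocallyConvexSpace ℝ X := (locallyConvexSpace_iff_real (𝕜 := 𝕜)).1 inferInstance
  obtain ⟨f, s, hs, hsx⟩ := RCLike.geometric_hahn_banach_closed_point (𝕜 := 𝕜)
    (convex_RCLike_iff_convex_real.1 hC.2) hcl hx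
  have hs0 : 0 < s := by simpa using hs 0 (hC.1.zero_mem hne)
  have hnorm (y : X) : ‖((s : 𝕜)⁻¹ • f) y‖ = s⁻¹ * ‖f y‖ := by
    simp [abs_of_pos hs0]
  refine ⟨(s : 𝕜)⁻¹ • f, fun y hy => ?_, ?_⟩
  · obtain ⟨c, hc, hcy⟩ := RCLike.exists_norm_eq_mul_self (f y)
    have hre : ‖f y‖ < s := by
      simpa [← hcy] using hs (c • y) (hC.1.smul_mem hc.le hy)
    change ‖((s : 𝕜)⁻¹ • f) y‖ ≤ 1
    rw [hnorm, inv_mul_le_iff₀ hs0, mul_one]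
    exact hre.le
  · rw [hnorm, lt_inv_mul_iff₀ hs0, mul_one]
    exact hsx.trans_le (RCLike.re_le_norm _)

theorem polar_strongDualPolar_eq_self {C : Set X} (hC : AbsConvex 𝕜 C) (hcl : IsClosed C)
    (hne : C.Nonempty) : (topDualPairing 𝕜 X).polar (StrongDual.polar 𝕜 C) = C := by
  refine Set.Subset.antisymm (fun x hx => ?_) ((topDualPairing 𝕜 X).flip.subset_bipolar C)
  by_contra hxC
  obtain ⟨f, hf, hfx⟩ := exists_mem_strongDualPolar_one_lt_norm hC hcl hne hxC
  exact hfx.not_ge (hx f hf)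

theorem isVonNBounded_polar_strongDualPolar {B : Set X} (hB : IsVonNBounded 𝕜 B) :
    IsVonNBounded 𝕜 ((topDualPairing 𝕜 X).polar (StrongDual.polar 𝕜 B)) := by
  rw [(nhds_hasBasis_absConvex_closed 𝕜 X).isVonNBounded_iff]
  rintro U ⟨hU, hUcl, hUabs⟩
  have hUU := polar_strongDualPolar_eq_self hUabs hUcl ⟨0, mem_of_mem_nhds hU⟩
  have hUB := hB hU
  change Absorbs 𝕜 U _
  rw [← hUU, absorbs_polar_comm] at hUB ⊢
  exact hUB.mono_left ((topDualPairing 𝕜 X).subset_bipolar (StrongDual.polar 𝕜 B))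

end Bipolar

section Compactness

variable {𝕜 X : Type*} [AddCommGroup X]

theorem continuous_of_forall_mem_nhds_norm_le [NontriviallyNormedField 𝕜] [Module 𝕜 X]
    [TopologicalSpace X] [IsTopologicalAddGroup X] [ContinuousSMul 𝕜 X] (f : Module.Dual 𝕜 X)
    {U : Set X} (hU : U ∈ 𝓝 0) {r : ℝ} (hf : ∀ x ∈ U, ‖f x‖ ≤ r) : Continuous f :=
  (f.clmOfExistsBoundedImage
    ⟨U, hU, (NormedSpace.image_isVonNBounded_iff 𝕜).2 ⟨r, hf⟩⟩).continuous

theorem isCompact_weakDualPolar [NontriviallyNormedField 𝕜] [ProperSpace 𝕜] [Module 𝕜 X]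
    [TopologicalSpace X] [IsTopologicalAddGroup X] [ContinuousSMul 𝕜 X] {U : Set X}
    (hU : U ∈ 𝓝 0) : IsCompact (WeakDual.polar 𝕜 U) := by
  choose r hr using fun x => exists_forall_mem_polar_norm_le_of_absorbs (topDualPairing 𝕜 X).flip
    (absorbent_nhds_zero (𝕜 := 𝕜) hU x)
  have hemb : IsEmbedding fun f : WeakDual 𝕜 X => (f : X → 𝕜) :=
    DFunLike.coe_injective.isEmbedding_induced
  have himage : (fun f : WeakDual 𝕜 X => (f : X → 𝕜)) '' WeakDual.polar 𝕜 U =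
      Set.range (DFunLike.coe : Module.Dual 𝕜 X → X → 𝕜) ∩ ⋂ x ∈ U, {g | ‖g x‖ ≤ 1} := by
    ext g
    simp only [Set.mem_image, Set.mem_inter_iff, Set.mem_range, Set.mem_iInter, Set.mem_ofPred_eq]
    constructor
    · rintro ⟨f, hf, rfl⟩
      exact ⟨⟨f.toLinearMap, rfl⟩, hf⟩
    · rintro ⟨⟨f, rfl⟩, hf⟩
      exact ⟨⟨f, continuous_of_forall_mem_nhds_norm_le f hU hf⟩, hf, rfl⟩
  rw [hemb.isCompact_iff]
  refine (isCompact_univ_pi fun x => isCompact_closedBall (0 : 𝕜) (r x)).of_isClosed_subset ?_ ?_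
  · rw [himage]
    exact (LinearMap.isClosed_range_coe X 𝕜 (RingHom.id 𝕜)).inter <|
      isClosed_biInter fun x _ => isClosed_le (continuous_apply x).norm continuous_const
  · rintro _ ⟨f, hf, rfl⟩ x -
    exact mem_closedBall_zero_iff.2 (hr x f hf x rfl)

theorem locallyConvexSpace_weakBilin {E V : Type*} [RCLike 𝕜] [AddCommGroup E] [Module 𝕜 E]
    [AddCommGroup V] [Module 𝕜 V] (p : E →ₗ[𝕜] V →ₗ[𝕜] 𝕜) :
    LocallyConvexSpace 𝕜 (WeakBilin p) := by
  let _ : Module ℝ E := .restrictScalars ℝ 𝕜 E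
  have : IsScalarTower ℝ 𝕜 E := .restrictScalars ℝ 𝕜 E
  exact locallyConvexSpace_iff_real.2 WeakBilin.locallyConvexSpace

theorem polar_polar_eq_self_of_isClosed {E V : Type*} [RCLike 𝕜] [AddCommGroup E] [Module 𝕜 E]
    [AddCommGroup V] [Module 𝕜 V] (p : E →ₗ[𝕜] V →ₗ[𝕜] 𝕜) {C : Set (WeakBilin p)}
    (hC : AbsConvex 𝕜 C) (hcl : IsClosed C) (hne : C.Nonempty) :
    p.flip.polar (p.polar C) = C := by
  have : LocallyConvexSpace 𝕜 (WeakBilin p) := locallyConvexSpace_weakBilin p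
  refine Set.Subset.antisymm (fun e he => ?_) (p.subset_bipolar C)
  by_contra heC
  obtain ⟨u, hu, hue⟩ := exists_mem_strongDualPolar_one_lt_norm hC hcl hne heC
  obtain ⟨v, rfl⟩ := LinearMap.dualEmbedding_surjective p u
  exact hue.not_ge (he v hu)

theorem exists_mem_forall_eq_apply_of_mem_bipolar [RCLike 𝕜] [Module 𝕜 X] [TopologicalSpace X]
    {C : Set X} (hC : AbsConvex 𝕜 C) (hcomp : IsCompact C) (hne : C.Nonempty)
    (φ : Module.Dual 𝕜 (StrongDual 𝕜 X)) (hφ : ∀ f ∈ StrongDual.polar 𝕜 C, ‖φ f‖ ≤ 1) :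
    ∃ x ∈ C, ∀ f : StrongDual 𝕜 X, φ f = f x := by
  let p : Module.Dual 𝕜 (StrongDual 𝕜 X) →ₗ[𝕜] StrongDual 𝕜 X →ₗ[𝕜] 𝕜 := LinearMap.id
  let j : X →ₗ[𝕜] WeakBilin p := (topDualPairing 𝕜 X).flip
  have : T2Space (WeakBilin p) := (WeakBilin.isEmbedding Function.injective_id).t2Space
  have hj : Continuous j := WeakBilin.continuous_of_continuous_eval p fun f => f.continuous
  have hjC : AbsConvex 𝕜 (j '' C) := by
    refine ⟨?_, hC.2.linear_image j⟩
    rintro a ha _ ⟨_, ⟨x, hx, rfl⟩, rfl⟩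
    exact ⟨a • x, hC.1.smul_mem ha hx, map_smul _ _ _⟩
  have hφC : φ ∈ p.flip.polar (p.polar (j '' C)) := fun f hf =>
    hφ f fun x hx => hf (j x) (Set.mem_image_of_mem j hx)
  obtain ⟨x, hx, rfl⟩ :=
    (polar_polar_eq_self_of_isClosed p hjC (hcomp.image hj).isClosed (hne.image j)).subset hφC
  exact ⟨x, hx, fun f => rfl⟩

end Compactness

section UniformBoundedness

theorem exists_forall_norm_le_of_forall_tsum {ι 𝕜 : Type*} [RCLike 𝕜] {D : Set (ι → 𝕜)}
    (hD : ∀ i, ∃ r : ℝ, ∀ f ∈ D, ‖f i‖ ≤ r)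
    (h : ∀ f : ℕ → ι → 𝕜, (∀ n, f n ∈ D) → ∀ a : ℕ → 𝕜, Summable (‖a ·‖) →
      ∃ r : ℝ, ∀ i, ‖∑' n, a n * f n i‖ ≤ r) :
    ∃ r : ℝ, ∀ f ∈ D, ∀ i, ‖f i‖ ≤ r := by
  by_contra! hcon
  choose f hfD i hfi using fun n : ℕ => hcon n
  choose C hC using hD
  let b (k : ℕ) : lp (fun _ : ℕ => 𝕜) ⊤ :=
    ⟨fun n => f n (i k), memℓp_infty ⟨C (i k), by rintro _ ⟨n, rfl⟩; exact hC _ _ (hfD n)⟩⟩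
  let u (k : ℕ) : lp (fun _ : ℕ => 𝕜) 1 →L[𝕜] 𝕜 :=
    lp.dualPairing ⊤ 1 (fun _ => (ContinuousLinearMap.mul 𝕜 𝕜).flip) (K := 1) (fun _ => by simp)
      (b k)
  have hu (k : ℕ) (a : lp (fun _ : ℕ => 𝕜) 1) : u k a = ∑' n, a n * f n (i k) := rfl
  obtain ⟨R, hR⟩ := banach_steinhaus (g := u) fun a => by
    obtain ⟨r, hr⟩ := h f hfD a (by simpa using (lp.memℓp a).summable (by simp))
    exact ⟨r, fun k => hr (i k)⟩
  obtain ⟨n, hn⟩ := exists_nat_gt R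
  have hun : u n (lp.single 1 n 1) = f n (i n) := by
    rw [hu, tsum_eq_single n fun k hk => by simp [lp.single_apply, hk]]
    simp
  have hle := (u n).le_of_opNorm_le (hR n) (lp.single 1 n 1)
  rw [hun, lp.norm_single (by simp), norm_one, mul_one] at hle
  exact ((hfi n).trans_le hle).not_gt hn

variable {𝕜 X : Type*} [RCLike 𝕜] [AddCommGroup X] [Module 𝕜 X] [TopologicalSpace X]
  [IsTopologicalAddGroup X] [ContinuousSMul 𝕜 X] [LocallyConvexSpace 𝕜 X]

theorem absorbs_of_forall_hasSum {U B : Set X} (hU : AbsConvex 𝕜 U) (hcl : IsClosed U)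
    (habs : Absorbent 𝕜 U)
    (h : ∀ f : ℕ → StrongDual 𝕜 X, (∀ n, f n ∈ StrongDual.polar 𝕜 U) →
      ∀ a : ℕ → 𝕜, Summable (‖a ·‖) →
      ∀ g : Module.Dual 𝕜 X, (∀ x, HasSum (fun n => a n * f n x) (g x)) →
      ∃ r : ℝ, ∀ x ∈ B, ‖g x‖ ≤ r) :
    Absorbs 𝕜 U B := by
  choose C hC using fun x =>
    exists_forall_mem_polar_norm_le_of_absorbs (topDualPairing 𝕜 X).flip (habs x)
  rw [← polar_strongDualPolar_eq_self hU hcl ⟨0, habs.zero_mem⟩, absorbs_polar_iff]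
  let D : Set (B → 𝕜) := (fun f x => f x) '' StrongDual.polar 𝕜 U
  have hD (x : B) : ∃ r : ℝ, ∀ F ∈ D, ‖F x‖ ≤ r :=
    ⟨C x, by rintro _ ⟨f, hf, rfl⟩; exact hC x f hf x rfl⟩
  suffices ∃ r : ℝ, ∀ F ∈ D, ∀ x, ‖F x‖ ≤ r from
    this.imp fun r hr f hf x hx => hr _ ⟨f, hf, rfl⟩ ⟨x, hx⟩
  refine exists_forall_norm_le_of_forall_tsum hD fun F hF a ha => ?_
  choose f hf hfF using hF
  obtain rfl : (fun n (x : B) => f n x) = F := funext hfF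
  have hsum (x : X) : Summable fun n => a n * f n x :=
    .of_norm_bounded (ha.mul_right (C x)) fun n => by
      rw [norm_mul]
      exact mul_le_mul_of_nonneg_left (hC x (f n) (hf n) x rfl) (norm_nonneg _)
  let g : Module.Dual 𝕜 X :=
    { toFun x := ∑' n, a n * f n x
      map_add' x y := by simp [mul_add, (hsum x).tsum_add (hsum y)]
      map_smul' c x := by simp [mul_left_comm, tsum_mul_left] }
  obtain ⟨r, hr⟩ := h f hf a ha g fun x => (hsum x).hasSum
  exact ⟨r, fun x => hr x x.2⟩

theorem isVonNBounded_of_forall_strongDual_bounded {B : Set X}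
    (hB : ∀ f : StrongDual 𝕜 X, ∃ r : ℝ, ∀ x ∈ B, ‖f x‖ ≤ r) : IsVonNBounded 𝕜 B := by
  rw [(nhds_hasBasis_absConvex_closed 𝕜 X).isVonNBounded_iff]
  rintro U ⟨hU, hUcl, hUabs⟩
  refine absorbs_of_forall_hasSum hUabs hUcl (absorbent_nhds_zero hU) fun f hf a ha g hg => ?_
  have hgU (x : X) (hx : x ∈ U) : ‖g x‖ ≤ ∑' n, ‖a n‖ := by
    rw [← (hg x).tsum_eq]
    refine tsum_of_norm_bounded ha.hasSum fun n => ?_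
    rw [norm_mul]
    exact mul_le_of_le_one_right (norm_nonneg _) (hf n x hx)
  exact hB ⟨g, continuous_of_forall_mem_nhds_norm_le g hU hgU⟩

end UniformBoundedness

section StrongDual

variable {𝕜 X : Type*} [RCLike 𝕜] [AddCommGroup X] [Module 𝕜 X]

theorem hasBasis_nhds_zero_strongDual [TopologicalSpace X] [ContinuousConstSMul 𝕜 X] :
    (𝓝 (0 : StrongDual 𝕜 X)).HasBasis (IsVonNBounded 𝕜) (StrongDual.polar 𝕜) := by
  refine (ContinuousLinearMap.hasBasis_nhds_zero_of_basis
    (Metric.nhds_basis_closedBall (x := (0 : 𝕜)))).to_hasBasis ?_ ?_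
  · rintro ⟨B, ε⟩ ⟨hB, hε : 0 < ε⟩
    refine ⟨_, hB.image ((ε : 𝕜)⁻¹ • ContinuousLinearMap.id 𝕜 X), fun f hf x hx => ?_⟩
    have hfx : ‖f ((ε : 𝕜)⁻¹ • x)‖ ≤ 1 := hf _ ⟨x, hx, rfl⟩
    rw [map_smul, norm_smul, norm_inv, RCLike.norm_ofReal, abs_of_pos hε,
      inv_mul_le_iff₀ hε, mul_one] at hfx
    exact mem_closedBall_zero_iff.2 hfx
  · exact fun B hB => ⟨(B, 1), ⟨hB, one_pos⟩, fun f hf x hx => mem_closedBall_zero_iff.1 (hf x hx)⟩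

instance locallyConvexSpace_strongDual [TopologicalSpace X] [ContinuousConstSMul 𝕜 X] :
    LocallyConvexSpace 𝕜 (StrongDual 𝕜 X) :=
  .ofBasisZero 𝕜 _ _ _ hasBasis_nhds_zero_strongDual fun B _ =>
    ((topDualPairing 𝕜 X).flip.polar_AbsConvex B).2

theorem completeSpace_strongDual [TopologicalSpace X] [ContinuousSMul 𝕜 X]
    (h : ∀ f : Module.Dual 𝕜 X, (∀ B : Set X, IsVonNBounded 𝕜 B → ContinuousOn f B) →
      Continuous f) : CompleteSpace (StrongDual 𝕜 X) := by
  let 𝔖 : Set (Set X) := {B | IsVonNBounded 𝕜 B}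
  have hind : IsUniformInducing fun f : StrongDual 𝕜 X => UniformOnFun.ofFun 𝔖 (f : X → 𝕜) :=
    ContinuousLinearMap.isUniformEmbedding_toUniformOnFun.isUniformInducing
  have hcont (B : Set X) (hB : B ∈ 𝔖) :
      IsClosed {f : UniformOnFun X 𝕜 𝔖 | ContinuousOn (UniformOnFun.toFun 𝔖 f) B} := by
    refine isClosed_iff_forall_filter.2 fun f u _ hu huf => ?_
    rw [← Filter.tendsto_id', UniformOnFun.tendsto_iff_tendstoUniformlyOn] at huf
    exact (huf B hB).continuousOn (Filter.Eventually.frequently (Filter.le_principal_iff.1 hu))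
  have hlin : IsClosed {f : UniformOnFun X 𝕜 𝔖 |
      ∃ g : Module.Dual 𝕜 X, (g : X → 𝕜) = UniformOnFun.toFun 𝔖 f} :=
    (LinearMap.isClosed_range_coe X 𝕜 (RingHom.id 𝕜)).preimage
      (UniformOnFun.uniformContinuous_toFun
        Bornology.sUnion_isVonNBounded_eq_univ).continuous
  rw [completeSpace_iff_isComplete_range hind]
  convert ((isClosed_biInter hcont).inter hlin).isComplete using 1
  ext f
  simp only [Set.mem_range, Set.mem_inter_iff, Set.mem_iInter, Set.mem_ofPred_eq]
  constructor
  · rintro ⟨g, rfl⟩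
    exact ⟨fun B _ => g.continuous.continuousOn, g.toLinearMap, rfl⟩
  · rintro ⟨hf, g, hg⟩
    exact ⟨⟨g, h g fun B hB => hg ▸ hf B hB⟩, hg⟩

end StrongDual

section SemiReflexive

variable {𝕜 X : Type*} [RCLike 𝕜] [AddCommGroup X] [Module 𝕜 X] [t : TopologicalSpace X]
  [ContinuousSMul 𝕜 X]

variable (𝕜 X) in
/-- The evaluation map of `X` into its strong bidual. -/
noncomputable def evalBidual : X →ₗ[𝕜] StrongDual 𝕜 (StrongDual 𝕜 X) where
  toFun x := ⟨(topDualPairing 𝕜 X).flip x, continuous_eval_const x⟩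
  map_add' x y := by ext f; exact map_add f x y
  map_smul' c x := by ext f; exact map_smul f c x

theorem surjective_evalBidual_iff :
    Function.Surjective (evalBidual 𝕜 X) ↔ IsSemiReflexive 𝕜 t :=
  forall_congr' fun _ => exists_congr fun _ =>
    ⟨fun h f => (DFunLike.congr_fun h f).symm, fun h => ContinuousLinearMap.ext fun f => (h f).symm⟩

variable [IsTopologicalAddGroup X] [LocallyConvexSpace 𝕜 X]

theorem injective_evalBidual [T2Space X] : Function.Injective (evalBidual 𝕜 X) := by
  refine (injective_iff_map_eq_zero _).2 fun x hx => by_contra fun hne => ?_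
  obtain ⟨f, -, hf⟩ := exists_mem_strongDualPolar_one_lt_norm (𝕜 := 𝕜) (C := {0}) (x := x)
    ⟨balanced_zero, convex_singleton 0⟩ isClosed_singleton (Set.singleton_nonempty 0) hne
  have hfx : f x = 0 := DFunLike.congr_fun hx f
  norm_num [hfx] at hf

theorem bijective_evalBidual [T2Space X] (hr : IsSemiReflexive 𝕜 t) :
    Function.Bijective (evalBidual 𝕜 X) :=
  ⟨injective_evalBidual, surjective_evalBidual_iff.2 hr⟩

theorem isSemiReflexive_of_montelSpace [MontelSpace 𝕜 X] : IsSemiReflexive 𝕜 t := by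
  intro u
  have hu : u ⁻¹' Metric.closedBall 0 1 ∈ 𝓝 (0 : StrongDual 𝕜 X) :=
    u.continuous.continuousAt.preimage_mem_nhds
      (by simpa only [map_zero] using Metric.closedBall_mem_nhds (0 : 𝕜) one_pos)
  obtain ⟨B, hB, huB⟩ := hasBasis_nhds_zero_strongDual.mem_iff.1 hu
  let C : Set X := (topDualPairing 𝕜 X).polar (StrongDual.polar 𝕜 B)
  have hC : IsCompact C := MontelSpace.isCompact_of_isClosed_of_isVonNBounded 𝕜
    (isClosed_polar_topDualPairing _) (isVonNBounded_polar_strongDualPolar hB)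
  obtain ⟨x, -, hx⟩ := exists_mem_forall_eq_apply_of_mem_bipolar (LinearMap.polar_AbsConvex _) hC
    ⟨0, LinearMap.zero_mem_polar _ _⟩ u.toLinearMap fun f hf =>
      mem_closedBall_zero_iff.1 (huB fun x hx =>
        hf x ((topDualPairing 𝕜 X).flip.subset_bipolar B hx))
  exact ⟨x, hx⟩

theorem isVonNBounded_polar_topDualPairing {W : Set (StrongDual 𝕜 X)} (habs : Absorbent 𝕜 W) :
    IsVonNBounded 𝕜 ((topDualPairing 𝕜 X).polar W) :=
  isVonNBounded_of_forall_strongDual_bounded fun f =>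
    (exists_forall_mem_polar_norm_le_of_absorbs (topDualPairing 𝕜 X) (habs f)).imp
      fun _ hr x hx => hr x hx f rfl

theorem mem_nhds_zero_strongDual_of_isClosed_of_absorbent (hr : IsSemiReflexive 𝕜 t)
    {W : Set (StrongDual 𝕜 X)} (hW : AbsConvex 𝕜 W) (hcl : IsClosed W) (habs : Absorbent 𝕜 W) :
    W ∈ 𝓝 0 := by
  refine Filter.mem_of_superset (hasBasis_nhds_zero_strongDual.mem_of_mem
    (isVonNBounded_polar_topDualPairing habs)) fun f hf => ?_
  by_contra hfW
  have hne : W.Nonempty := ⟨0, Absorbent.zero_mem (G₀ := 𝕜) habs⟩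
  obtain ⟨u, hu, huf⟩ : ∃ u ∈ StrongDual.polar 𝕜 W, 1 < ‖u f‖ := by
    apply exists_mem_strongDualPolar_one_lt_norm <;> assumption
  obtain ⟨x, hx⟩ := hr u
  rw [hx f] at huf
  exact huf.not_ge (hf x fun g hg => (congrArg norm (hx g)).symm.trans_le (hu g hg))

theorem barrelledSpace_strongDual (hr : IsSemiReflexive 𝕜 t) :
    BarrelledSpace 𝕜 (StrongDual 𝕜 X) where
  continuous_of_lowerSemicontinuous p hp := by
    have hcl : IsClosed (p.closedBall 0 1) := by
      rw [p.closedBall_zero_eq]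
      exact hp.isClosed_preimage 1
    have hconv : AbsConvex 𝕜 (p.closedBall 0 1) :=
      ⟨p.balanced_closedBall_zero 1, convex_RCLike_iff_convex_real.2 (p.convex_closedBall 0 1)⟩
    exact Seminorm.continuous' (r := 1) <| mem_nhds_zero_strongDual_of_isClosed_of_absorbent hr
      hconv hcl (p.absorbent_closedBall_zero one_pos)

end SemiReflexive

section Topologies

variable {𝕜 : Type*} [RCLike 𝕜] {X : Type*} [AddCommGroup X] [Module 𝕜 X]
  {E : Type*} [AddCommGroup E] [Module 𝕜 E] [TopologicalSpace E] [IsTopologicalAddGroup E]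
  [ContinuousSMul 𝕜 E] [LocallyConvexSpace 𝕜 E]

theorem isLCHausdorff_induced [T2Space E] (L : X →ₗ[𝕜] E) (hL : Function.Injective L) :
    IsLCHausdorff 𝕜 (TopologicalSpace.induced L inferInstance) where
  isTopologicalAddGroup := topologicalAddGroup_induced L
  continuousSMul := continuousSMul_induced L
  locallyConvexSpace := LocallyConvexSpace.induced L
  t2Space := by
    let _ : TopologicalSpace X := TopologicalSpace.induced L inferInstance
    exact (IsEmbedding.mk ⟨rfl⟩ hL).t2Space

theorem IsLCHausdorff.inf_induced {τ : TopologicalSpace X} (h : IsLCHausdorff 𝕜 τ)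
    (L : X →ₗ[𝕜] E) : IsLCHausdorff 𝕜 (τ ⊓ TopologicalSpace.induced L inferInstance) where
  isTopologicalAddGroup :=
    topologicalAddGroup_inf h.isTopologicalAddGroup (topologicalAddGroup_induced L)
  continuousSMul := @continuousSMul_inf _ _ _ _ _ _ h.continuousSMul (continuousSMul_induced L)
  locallyConvexSpace := LocallyConvexSpace.inf h.locallyConvexSpace (LocallyConvexSpace.induced L)
  t2Space := t2Space_antitone inf_le_left h.t2Space

end Topologies

section Restriction

variable {X : Type*} {E : Type*} [TopologicalSpace E]

theorem induced_inf_induced_eq (τ : TopologicalSpace X) (L : X → E) {B : Set X}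
    (hL : @ContinuousOn X E τ _ L B) :
    TopologicalSpace.induced ((↑) : B → X) (τ ⊓ TopologicalSpace.induced L inferInstance) =
      TopologicalSpace.induced ((↑) : B → X) τ := by
  rw [induced_inf, inf_eq_left, induced_compose, ← continuous_iff_le_induced]
  exact continuousOn_iff_continuous_domRestrict.1 hL

theorem isCompact_iff_of_induced_eq {τ σ : TopologicalSpace X} {C : Set X}
    (h : TopologicalSpace.induced ((↑) : C → X) σ = TopologicalSpace.induced ((↑) : C → X) τ) :
    @IsCompact X σ C ↔ @IsCompact X τ C := by
  rw [@isCompact_iff_compactSpace X σ C, @isCompact_iff_compactSpace X τ C]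
  change @CompactSpace C (TopologicalSpace.induced _ _) ↔
    @CompactSpace C (TopologicalSpace.induced _ _)
  rw [h]

theorem continuousOn_iff_of_induced_eq {τ σ : TopologicalSpace X}
    {C : Set X} (f : X → E)
    (h : TopologicalSpace.induced ((↑) : C → X) σ = TopologicalSpace.induced ((↑) : C → X) τ) :
    @ContinuousOn X E σ _ f C ↔ @ContinuousOn X E τ _ f C := by
  rw [@continuousOn_iff_continuous_domRestrict X E σ,
    @continuousOn_iff_continuous_domRestrict X E τ]
  change @Continuous C E (TopologicalSpace.induced _ _) _ _ ↔
    @Continuous C E (TopologicalSpace.induced _ _) _ _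
  rw [h]

end Restriction

section MixedTopology

variable {𝕜 : Type*} [RCLike 𝕜] {X : Type*} [AddCommGroup X] [Module 𝕜 X]
  {τ τt : TopologicalSpace X}

theorem BBC.of_induced_eq {σ : TopologicalSpace X} (h : BBC 𝕜 τ τt)
    (hσ : ∀ B, IsBdd 𝕜 τ B →
      TopologicalSpace.induced ((↑) : B → X) σ = TopologicalSpace.induced ((↑) : B → X) τt) :
    BBC 𝕜 τ σ := fun B hB => by
  obtain ⟨C, hBC, hC, hCb, hCc⟩ := h B hB
  exact ⟨C, hBC, hC, hCb, (isCompact_iff_of_induced_eq (hσ C hCb)).2 hCc⟩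

theorem BBC.bbcl [σ : TopologicalSpace X] [T2Space X] (h : BBC 𝕜 τ σ) : BBCl 𝕜 τ σ := fun B hB => by
  obtain ⟨C, hBC, hC, hCb, hCc⟩ := h B hB
  exact ⟨C, hBC, hC, hCb, hCc.isClosed⟩

theorem BBC.montelSpace [σ : TopologicalSpace X] (h : BBC 𝕜 τ σ) (hs : SameBounded 𝕜 τ σ) :
    MontelSpace 𝕜 X where
  heine_borel s hcl hb := by
    obtain ⟨C, hC, -, -, hCc⟩ := h s ((hs s).2 hb)
    exact hCc.of_isClosed_subset hcl hC

theorem CNC.mono {σ : TopologicalSpace X} (h : CNC 𝕜 τ τt) (hσ : σ ≤ τt) : CNC 𝕜 τ σ := by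
  obtain ⟨U₀, hU₀, hb⟩ := h
  exact ⟨U₀, fun U hU => ⟨(hU₀ U hU).1, (hU₀ U hU).2.mono hσ⟩, hb⟩

theorem gammaTilde_le (h : IsLCHausdorff 𝕜 τt) : gammaTilde 𝕜 τ τt ≤ τt :=
  sInf_le ⟨h, fun _ _ => rfl⟩

theorem mem_boundedDual_iff (h : IsLCHausdorff 𝕜 τt) (f : Module.Dual 𝕜 X) :
    f ∈ boundedDual 𝕜 τ τt ↔ @Continuous X 𝕜 (gammaTilde 𝕜 τ τt) _ f := by
  constructor
  · intro hf
    rw [continuous_iff_le_induced]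
    have hmem : τt ⊓ TopologicalSpace.induced f inferInstance ∈ mixedTopologies 𝕜 τ τt :=
      ⟨h.inf_induced f, fun B hB => induced_inf_induced_eq τt f (hf B hB)⟩
    exact (sInf_le hmem).trans inf_le_right
  · intro hf B hB
    exact (continuousOn_iff_of_induced_eq f ((isLeast_gammaTilde (𝕜 := 𝕜) τ τt h).1.2 B hB)).1
      (@Continuous.continuousOn X 𝕜 (gammaTilde 𝕜 τ τt) _ f B hf)

theorem mem_boundedDual_of_hasSum [TopologicalSpace X] {U : Set X}
    (hU : ∀ B, IsBdd 𝕜 τ B → Absorbs 𝕜 U B) {f : ℕ → StrongDual 𝕜 X}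
    (hf : ∀ n, f n ∈ StrongDual.polar 𝕜 U) {a : ℕ → 𝕜} (ha : Summable (‖a ·‖))
    {g : Module.Dual 𝕜 X} (hg : ∀ x, HasSum (fun n => a n * f n x) (g x)) :
    g ∈ boundedDual 𝕜 τ inferInstance := by
  intro B hB
  obtain ⟨r, hr⟩ := exists_forall_mem_polar_norm_le_of_absorbs (topDualPairing 𝕜 X).flip (hU B hB)
  have hsum : (g : X → 𝕜) = fun x => ∑' n, a n * f n x := funext fun x => (hg x).tsum_eq.symm
  rw [hsum]
  refine continuousOn_tsum (fun n => (continuous_const.mul (f n).continuous).continuousOn)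
    (ha.mul_right r) fun n x hx => ?_
  rw [norm_mul]
  exact mul_le_mul_of_nonneg_left (hr (f n) (hf n) x hx) (norm_nonneg _)

theorem BBC.isBdd_gammaTilde (hB : BBC 𝕜 τ τt) (h : IsLCHausdorff 𝕜 τt) {B : Set X}
    (hBτ : IsBdd 𝕜 τ B) : IsBdd 𝕜 (gammaTilde 𝕜 τ τt) B := by
  have hγ := (isLeast_gammaTilde (𝕜 := 𝕜) τ τt h).1
  obtain ⟨C, hBC, -, -, hCc⟩ := hB.of_induced_eq hγ.2 B hBτ
  let _ : TopologicalSpace X := gammaTilde 𝕜 τ τt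
  have := hγ.1.isTopologicalAddGroup
  have := hγ.1.continuousSMul
  exact (IsCompact.isVonNBounded 𝕜 hCc).subset hBC

theorem CNC.isBdd_of_isBdd_gammaTilde (hC : CNC 𝕜 τ τt) (hτ : IsLCHausdorff 𝕜 τ)
    (h : IsLCHausdorff 𝕜 τt) {B : Set X} (hB : IsBdd 𝕜 (gammaTilde 𝕜 τ τt) B) :
    IsBdd 𝕜 τ B := by
  obtain ⟨U₀, hU₀, hb⟩ := hC
  intro V hV
  obtain ⟨U, hU, hUV : U ⊆ V⟩ := hb.mem_iff.1 hV
  have hU0 : U ∈ @nhds X τ 0 := hb.mem_of_mem hU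
  have habs : Absorbent 𝕜 U := @absorbent_nhds_zero _ _ _ _ _ U τ hτ.continuousSMul hU0
  have ⟨_, _, _, _⟩ := h
  refine Absorbs.mono_left (absorbs_of_forall_hasSum (hU₀ U hU).1 (hU₀ U hU).2 habs
    fun f hf a ha g hg => ?_) hUV
  have hgγ := (mem_boundedDual_iff h g).1 (mem_boundedDual_of_hasSum (fun B hB => hB hU0) hf ha hg)
  let _ : TopologicalSpace X := gammaTilde 𝕜 τ τt
  exact (NormedSpace.image_isVonNBounded_iff 𝕜).1 (hB.image (⟨g, hgγ⟩ : StrongDual 𝕜 X))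

theorem BBC.isSemiReflexive_gammaTilde (hB : BBC 𝕜 τ τt) (h : IsLCHausdorff 𝕜 τt)
    (hs : SameBounded 𝕜 τ (gammaTilde 𝕜 τ τt)) : IsSemiReflexive 𝕜 (gammaTilde 𝕜 τ τt) := by
  have hγ := (isLeast_gammaTilde (𝕜 := 𝕜) τ τt h).1
  let _ : TopologicalSpace X := gammaTilde 𝕜 τ τt
  have ⟨_, _, _, _⟩ := hγ.1
  have := (hB.of_induced_eq hγ.2).montelSpace hs
  exact isSemiReflexive_of_montelSpace

theorem sameBounded_gammaTilde (hτ : IsLCHausdorff 𝕜 τ) (h : IsLCHausdorff 𝕜 τt)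
    (hB : BBC 𝕜 τ τt) (hC : CNC 𝕜 τ τt) : SameBounded 𝕜 τ (gammaTilde 𝕜 τ τt) := fun _ =>
  ⟨hB.isBdd_gammaTilde h, hC.isBdd_of_isBdd_gammaTilde hτ h⟩

end MixedTopology

section Bidual

variable {𝕜 X : Type*} [RCLike 𝕜] [AddCommGroup X] [Module 𝕜 X]

theorem isVonNBounded_strongDualPolar [TopologicalSpace X] [ContinuousConstSMul 𝕜 X] {U : Set X}
    (hU : ∀ B : Set X, IsVonNBounded 𝕜 B → Absorbs 𝕜 U B) :
    IsVonNBounded 𝕜 (StrongDual.polar 𝕜 U) := by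
  rw [hasBasis_nhds_zero_strongDual.isVonNBounded_iff]
  intro B hB
  exact (absorbs_polar_comm (topDualPairing 𝕜 X)).1 <|
    (hU B hB).mono_left ((topDualPairing 𝕜 X).flip.subset_bipolar U)

theorem isHomeomorph_of_nhds_zero_eq {G H : Type*} [AddCommGroup G] [AddCommGroup H]
    [tG : TopologicalSpace G] [TopologicalSpace H] [IsTopologicalAddGroup G]
    [IsTopologicalAddGroup H] {F : Type*} [FunLike F G H]
    [AddMonoidHomClass F G H] (e : F) (he : Function.Bijective e)
    (h : 𝓝 (0 : G) = Filter.comap e (𝓝 0)) : IsHomeomorph e := by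
  have hind : IsInducing e := ⟨IsTopologicalAddGroup.ext inferInstance
    (topologicalAddGroup_induced e) (by rw [nhds_induced, map_zero, h])⟩
  exact isHomeomorph_iff_isEmbedding_surjective.2 ⟨⟨hind, he.1⟩, he.2⟩

variable {τ : TopologicalSpace X} [σ : TopologicalSpace X] [ContinuousSMul 𝕜 X]

theorem IsBornological.nhds_zero_le_comap_evalBidual (hborn : IsBornological 𝕜 τ)
    (h : ∀ B, IsBdd 𝕜 τ B → IsBdd 𝕜 σ B) :
    @nhds X τ 0 ≤ Filter.comap (evalBidual 𝕜 X) (𝓝 0) := by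
  refine (hasBasis_nhds_zero_strongDual.comap _).ge_iff.2 fun M hM => ?_
  have hpre : evalBidual 𝕜 X ⁻¹' StrongDual.polar 𝕜 M = (topDualPairing 𝕜 X).polar M := rfl
  rw [hpre]
  refine hborn _ (LinearMap.polar_AbsConvex M) fun B hB => ?_
  rw [absorbs_polar_comm]
  exact hM (hasBasis_nhds_zero_strongDual.mem_of_mem (h B hB))

variable [IsTopologicalAddGroup X] [LocallyConvexSpace 𝕜 X]

theorem CNC.comap_evalBidual_nhds_zero_le (hC : CNC 𝕜 τ σ)
    (h : ∀ B, IsBdd 𝕜 σ B → IsBdd 𝕜 τ B) :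
    Filter.comap (evalBidual 𝕜 X) (𝓝 0) ≤ @nhds X τ 0 := by
  obtain ⟨U₀, hU₀, hb⟩ := hC
  refine hb.ge_iff.2 fun U hU => ?_
  have hU0 : U ∈ @nhds X τ 0 := hb.mem_of_mem hU
  have hbipolar : evalBidual 𝕜 X ⁻¹' StrongDual.polar 𝕜 (StrongDual.polar 𝕜 U) = U :=
    polar_strongDualPolar_eq_self (hU₀ U hU).1 (hU₀ U hU).2 ⟨0, @mem_of_mem_nhds X τ 0 U hU0⟩
  rw [id, ← hbipolar]
  exact Filter.preimage_mem_comap <| hasBasis_nhds_zero_strongDual.mem_of_mem <|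
    isVonNBounded_strongDualPolar fun B hB => h B hB hU0

theorem isHomeomorph_evalBidual [T2Space X] (hτ : IsLCHausdorff 𝕜 τ) (hborn : IsBornological 𝕜 τ)
    (hr : IsSemiReflexive 𝕜 σ) (hs : SameBounded 𝕜 τ σ) (hC : CNC 𝕜 τ σ) :
    @IsHomeomorph X (StrongDual 𝕜 (StrongDual 𝕜 X)) τ _ (evalBidual 𝕜 X) := by
  have := hτ.isTopologicalAddGroup
  exact isHomeomorph_of_nhds_zero_eq (tG := τ) (evalBidual 𝕜 X)
    (bijective_evalBidual hr) <|
    le_antisymm (hborn.nhds_zero_le_comap_evalBidual fun B => (hs B).1)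
      (hC.comap_evalBidual_nhds_zero_le fun B => (hs B).2)

end Bidual

section WeakStarTopology

variable {𝕜 X E : Type*} [RCLike 𝕜] [AddCommGroup X] [Module 𝕜 X] [AddCommGroup E] [Module 𝕜 E]
  {σ σt : TopologicalSpace E}

theorem absConvex_preimage (L : X →ₗ[𝕜] E) {C : Set E} (hC : AbsConvex 𝕜 C) :
    AbsConvex 𝕜 (L ⁻¹' C) :=
  ⟨hC.1.mulActionHom_preimage L.toMulActionHom, hC.2.linear_preimage L⟩

theorem isBdd_induced_iff (e : X ≃ₗ[𝕜] E) {B : Set X} :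
    IsBdd 𝕜 (TopologicalSpace.induced e σ) B ↔ IsBdd 𝕜 σ (e '' B) := by
  let _ : TopologicalSpace X := TopologicalSpace.induced e σ
  let e' : X ≃L[𝕜] E := ⟨e, continuous_induced_dom, continuous_induced_rng.2 <| by
    convert continuous_id
    exact funext e.apply_symm_apply⟩
  refine ⟨fun h => h.image (e' : X →L[𝕜] E), fun h => ?_⟩
  have hB : e'.symm '' (e' '' B) = B := e'.symm_image_image B
  exact hB ▸ h.image (e'.symm : E →L[𝕜] X)

theorem BBC.induced (h : BBC 𝕜 σ σt) (e : X ≃ₗ[𝕜] E) :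
    BBC 𝕜 (TopologicalSpace.induced e σ) (TopologicalSpace.induced e σt) := fun B hB => by
  obtain ⟨C, hBC, hC, hCb, hCc⟩ := h _ ((isBdd_induced_iff e).1 hB)
  have himage : e '' (e ⁻¹' C) = C := Set.image_preimage_eq C e.surjective
  refine ⟨e ⁻¹' C, Set.image_subset_iff.1 hBC, absConvex_preimage (e : X →ₗ[𝕜] E) hC, ?_, ?_⟩
  · rwa [isBdd_induced_iff, himage]
  · let _ : TopologicalSpace X := TopologicalSpace.induced e σt
    exact (IsInducing.mk rfl : IsInducing e).isCompact_iff.2 (himage.symm ▸ hCc)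

theorem CNC.induced (h : CNC 𝕜 σ σt) (e : X →ₗ[𝕜] E) :
    CNC 𝕜 (TopologicalSpace.induced e σ) (TopologicalSpace.induced e σt) := by
  obtain ⟨U₀, hU₀, hb⟩ := h
  refine ⟨Set.preimage e '' U₀, ?_, ?_⟩
  · rintro _ ⟨U, hU, rfl⟩
    exact ⟨absConvex_preimage e (hU₀ U hU).1,
      (@isClosed_induced_iff _ _ σt _ _).2 ⟨U, (hU₀ U hU).2, rfl⟩⟩
  · rw [@nhds_induced _ _ σ, map_zero]
    refine (hb.comap e).to_hasBasis (fun U hU => ⟨_, ⟨U, hU, rfl⟩, subset_rfl⟩) ?_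
    rintro _ ⟨U, hU, rfl⟩
    exact ⟨U, hU, subset_rfl⟩

variable {Y : Type*} [AddCommGroup Y] [Module 𝕜 Y]

theorem exists_mem_nhds_subset_strongDualPolar [TopologicalSpace Y] [IsTopologicalAddGroup Y]
    [ContinuousSMul 𝕜 Y] [BarrelledSpace 𝕜 Y] {B : Set (StrongDual 𝕜 Y)}
    (hB : IsVonNBounded 𝕜 B) : ∃ U ∈ 𝓝 (0 : Y), B ⊆ StrongDual.polar 𝕜 U := by
  let _ : UniformSpace Y := IsTopologicalAddGroup.rightUniformSpace Y
  have : IsUniformAddGroup Y := isUniformAddGroup_of_addCommGroup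
  have hpointwise (y : Y) : IsVonNBounded 𝕜 (Set.range fun f : B => f.1 y) :=
    (hB.image (evalBidual 𝕜 Y y)).subset <| by
      rintro _ ⟨f, rfl⟩
      exact ⟨f, f.2, rfl⟩
  have hequi : UniformEquicontinuous (DFunLike.coe ∘ fun f : B => f.1) :=
    PolynormableSpace.banach_steinhaus (𝕜₁ := 𝕜) (𝕜₂ := 𝕜) hpointwise
  refine ⟨_, hequi.equicontinuous 0 _ (Metric.dist_mem_uniformity one_pos), fun f hf y hy => ?_⟩
  have : dist (f 0) (f y) < 1 := hy ⟨f, hf⟩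
  simpa using this.le

theorem BBC_strongDual_weakStar [TopologicalSpace Y] [IsTopologicalAddGroup Y] [ContinuousSMul 𝕜 Y]
    [BarrelledSpace 𝕜 Y] : BBC 𝕜 (inferInstance : TopologicalSpace (StrongDual 𝕜 Y))
      (TopologicalSpace.induced StrongDual.toWeakDual inferInstance) := fun B hB => by
  obtain ⟨U, hU, hBU⟩ := exists_mem_nhds_subset_strongDualPolar hB
  refine ⟨_, hBU, LinearMap.polar_AbsConvex U,
    isVonNBounded_strongDualPolar fun B hB => hB hU, ?_⟩
  have himage : StrongDual.toWeakDual '' StrongDual.polar 𝕜 U = WeakDual.polar 𝕜 U :=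
    StrongDual.toWeakDual.toEquiv.image_eq_preimage_symm _
  let _ : TopologicalSpace (StrongDual 𝕜 Y) :=
    TopologicalSpace.induced StrongDual.toWeakDual inferInstance
  have hind : IsInducing (StrongDual.toWeakDual : StrongDual 𝕜 Y → WeakDual 𝕜 Y) := ⟨rfl⟩
  exact hind.isCompact_iff.2 (himage.symm ▸ isCompact_weakDualPolar hU)

theorem CNC_strongDual_weakStar [TopologicalSpace Y] [ContinuousConstSMul 𝕜 Y] :
    CNC 𝕜 (inferInstance : TopologicalSpace (StrongDual 𝕜 Y))
      (TopologicalSpace.induced StrongDual.toWeakDual inferInstance) := by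
  refine ⟨StrongDual.polar 𝕜 '' {B : Set Y | IsVonNBounded 𝕜 B}, ?_, ?_⟩
  · rintro _ ⟨B, -, rfl⟩
    exact ⟨LinearMap.polar_AbsConvex B,
      isClosed_induced_iff.2 ⟨WeakDual.polar 𝕜 B, WeakDual.isClosed_polar 𝕜 B, rfl⟩⟩
  · refine hasBasis_nhds_zero_strongDual.to_hasBasis
      (fun B hB => ⟨_, ⟨B, hB, rfl⟩, subset_rfl⟩) ?_
    rintro _ ⟨B, hB, rfl⟩
    exact ⟨B, hB, subset_rfl⟩

theorem exists_BBC_CNC_of_isHomeomorph_strongDual [TopologicalSpace Y] [IsTopologicalAddGroup Y]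
    [ContinuousSMul 𝕜 Y] [BarrelledSpace 𝕜 Y] {τ : TopologicalSpace X}
    (T : X ≃ₗ[𝕜] StrongDual 𝕜 Y) (hT : @IsHomeomorph X (StrongDual 𝕜 Y) τ _ T) :
    ∃ τt : TopologicalSpace X, IsLCHausdorff 𝕜 τt ∧ BBC 𝕜 τ τt ∧ CNC 𝕜 τ τt ∧
      ∀ y : Y, @Continuous X 𝕜 τt _ fun x => T x y := by
  have : LocallyConvexSpace 𝕜 (WeakDual 𝕜 Y) := locallyConvexSpace_weakBilin _
  let L : X ≃ₗ[𝕜] WeakDual 𝕜 Y := T.trans StrongDual.toWeakDual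
  have hτ : τ = TopologicalSpace.induced T inferInstance := hT.isInducing.eq_induced
  have hL : TopologicalSpace.induced L inferInstance = TopologicalSpace.induced T
      (TopologicalSpace.induced StrongDual.toWeakDual inferInstance) :=
    (induced_compose (f := T) (g := StrongDual.toWeakDual)).symm
  refine ⟨TopologicalSpace.induced L inferInstance,
    isLCHausdorff_induced L.toLinearMap L.injective, ?_, ?_, fun y => ?_⟩
  · rw [hτ, hL]
    exact BBC_strongDual_weakStar.induced T
  · rw [hτ, hL]
    exact CNC_strongDual_weakStar.induced T.toLinearMap
  · let _ : TopologicalSpace X := TopologicalSpace.induced L inferInstance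
    exact (WeakDual.eval_continuous y).comp (continuous_induced_dom (f := L))

end WeakStarTopology

section UniverseLift

theorem montelSpace_of_continuousLinearEquiv {𝕜 X Y : Type*} [NontriviallyNormedField 𝕜]
    [AddCommGroup X] [Module 𝕜 X] [TopologicalSpace X] [AddCommGroup Y] [Module 𝕜 Y]
    [TopologicalSpace Y] [MontelSpace 𝕜 X] (e : Y ≃L[𝕜] X) : MontelSpace 𝕜 Y where
  heine_borel s hcl hb := e.toHomeomorph.isCompact_image.1 <|
    MontelSpace.isCompact_of_isClosed_of_isVonNBounded 𝕜
      (e.toHomeomorph.isClosedMap s hcl) (hb.image (e : Y →L[𝕜] X))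

variable {𝕜 : Type v} [RCLike 𝕜] {Ω : Type u} {F : Submodule 𝕜 (Ω → 𝕜)} {τ : TopologicalSpace F}

theorem HasSemiMontelPrebidualWithEvaluations.ulift
    (h : HasSemiMontelPrebidualWithEvaluations.{u, v, 0} F τ) :
    HasSemiMontelPrebidualWithEvaluations.{u, v, w} F τ := by
  obtain ⟨Y, _, _, _, hY, _, hcomplete, φ, hφ, hδ⟩ := h
  have ⟨_, _, _, _⟩ := hY
  let e : ULift.{w} Y ≃L[𝕜] Y := ContinuousLinearEquiv.ulift
  let e' : StrongDual 𝕜 (ULift.{w} Y) ≃L[𝕜] StrongDual 𝕜 Y := e.arrowCongr (.refl 𝕜 𝕜)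
  let e'' : StrongDual 𝕜 (StrongDual 𝕜 Y) ≃L[𝕜] StrongDual 𝕜 (StrongDual 𝕜 (ULift.{w} Y)) :=
    e'.symm.arrowCongr (.refl 𝕜 𝕜)
  exact ⟨ULift.{w} Y, inferInstance, inferInstance, inferInstance,
    isLCHausdorff_induced e.toLinearMap e.injective, montelSpace_of_continuousLinearEquiv e,
    (completeSpace_congr (e := e'.toEquiv) e'.isUniformEmbedding).2 hcomplete,
    φ.trans e''.toLinearEquiv, e''.toHomeomorph.isHomeomorph.comp hφ,
    fun x => e'.toEquiv.existsUnique_congr_right.2 (hδ x)⟩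

end UniverseLift

section FunctionSpaces

variable {𝕜 : Type v} [RCLike 𝕜] {Ω : Type u} {F : Submodule 𝕜 (Ω → 𝕜)}
  {τ τt : TopologicalSpace F}

theorem le_pointwiseTopology_iff :
    τt ≤ pointwiseTopology F ↔ ∀ x, @Continuous F 𝕜 τt _ (pointEval F x) := by
  rw [pointwiseTopology, ← continuous_iff_le_induced]
  exact continuous_pi_iff

theorem IsStrongLinearisation.exists_BBC_CNC {Y : Type*} [AddCommGroup Y] [Module 𝕜 Y]
    [TopologicalSpace Y] [IsTopologicalAddGroup Y] [ContinuousSMul 𝕜 Y] [BarrelledSpace 𝕜 Y]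
    {δ : Ω → Y} {T : F ≃ₗ[𝕜] StrongDual 𝕜 Y} (hT : IsStrongLinearisation F τ δ T) :
    ∃ τt : TopologicalSpace F, IsLCHausdorff 𝕜 τt ∧ τt ≤ pointwiseTopology F ∧
      BBC 𝕜 τ τt ∧ CNC 𝕜 τ τt := by
  obtain ⟨τt, h, hB, hC, hcont⟩ := exists_BBC_CNC_of_isHomeomorph_strongDual T hT.1
  refine ⟨τt, h, le_pointwiseTopology_iff.2 fun x => ?_, hB, hC⟩
  have hx : (pointEval F x : F → 𝕜) = fun f => T f (δ x) :=
    funext fun f => (congrFun (hT.2 f) x).symm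
  exact hx ▸ hcont (δ x)

theorem AdmitsStrongCompleteBarrelledLinearisation.exists_BBC_CNC
    (h : AdmitsStrongCompleteBarrelledLinearisation.{u, v, w} F τ) :
    ∃ τt : TopologicalSpace F, IsLCHausdorff 𝕜 τt ∧ τt ≤ pointwiseTopology F ∧
      BBC 𝕜 τ τt ∧ CNC 𝕜 τ τt := by
  obtain ⟨Y, _, _, _, _, hY, -, _, δ, T, hT⟩ := h
  have := hY.continuousSMul
  exact hT.exists_BBC_CNC

theorem pointEval_mem_boundedDual (hp : τt ≤ pointwiseTopology F) (x : Ω) :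
    pointEval F x ∈ boundedDual 𝕜 τ τt := fun B _ =>
  @Continuous.continuousOn F 𝕜 τt _ _ B (le_pointwiseTopology_iff.1 hp x)

theorem BBC.inf_pointwiseTopology (hB : BBC 𝕜 τ τt)
    (hx : ∀ x, pointEval F x ∈ boundedDual 𝕜 τ τt) : BBC 𝕜 τ (τt ⊓ pointwiseTopology F) :=
  hB.of_induced_eq fun B hB => by
    refine induced_inf_induced_eq τt F.subtype ?_
    let _ := τt
    exact continuousOn_pi.2 fun x => hx x B hB

theorem continuous_pointEval_gammaTilde (h : IsLCHausdorff 𝕜 τt) (hp : τt ≤ pointwiseTopology F)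
    (x : Ω) : @Continuous F 𝕜 (gammaTilde 𝕜 τ τt) _ (pointEval F x) :=
  (mem_boundedDual_iff h _).1 (pointEval_mem_boundedDual hp x)

theorem HasSemiMontelPrebidualWithEvaluations.of_BBC_CNC (hτ : IsLCHausdorff 𝕜 τ)
    (hborn : IsBornological 𝕜 τ) (h : IsLCHausdorff 𝕜 τt) (hp : τt ≤ pointwiseTopology F)
    (hB : BBC 𝕜 τ τt) (hC : CNC 𝕜 τ τt) (hs : SameBounded 𝕜 τ (gammaTilde 𝕜 τ τt)) :
    HasSemiMontelPrebidualWithEvaluations.{u, v, w} F τ := by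
  have hγ := (isLeast_gammaTilde (𝕜 := 𝕜) τ τt h).1
  have hδ := continuous_pointEval_gammaTilde (𝕜 := 𝕜) (τ := τ) h hp
  have hr := hB.isSemiReflexive_gammaTilde h hs
  let _ : TopologicalSpace F := gammaTilde 𝕜 τ τt
  have ⟨_, _, _, _⟩ := hγ.1
  have hcomplete : CompleteSpace (StrongDual 𝕜 F) := completeSpace_strongDual fun f hf =>
    (mem_boundedDual_iff h f).1 fun B hB =>
      (continuousOn_iff_of_induced_eq f (hγ.2 B hB)).1 (hf B ((hs B).1 hB))
  exact .ulift ⟨F, inferInstance, inferInstance, inferInstance, hγ.1,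
    (hB.of_induced_eq hγ.2).montelSpace hs, hcomplete,
    LinearEquiv.ofBijective (evalBidual 𝕜 F) (bijective_evalBidual hr),
    isHomeomorph_evalBidual hτ hborn hr hs (hC.mono (gammaTilde_le h)),
    fun x => ⟨⟨pointEval F x, hδ x⟩, fun _ => rfl,
      fun y hy => ContinuousLinearMap.ext fun f => (hy f).symm⟩⟩

theorem HasSemiMontelPrebidualWithEvaluations.admitsStrongCompleteBarrelledLinearisation
    (h : HasSemiMontelPrebidualWithEvaluations.{u, v, w} F τ) :
    AdmitsStrongCompleteBarrelledLinearisation.{u, v, w} F τ := by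
  obtain ⟨Y, _, _, _, hY, _, hcomplete, φ, hφ, hδ⟩ := h
  have ⟨_, _, _, _⟩ := hY
  choose δ hδ _ using hδ
  exact ⟨StrongDual 𝕜 Y, inferInstance, inferInstance, inferInstance, inferInstance,
    ⟨inferInstance, inferInstance, inferInstance, inferInstance⟩, hcomplete,
    barrelledSpace_strongDual isSemiReflexive_of_montelSpace, δ, φ, hφ,
    fun f => funext fun x => (hδ x f).symm⟩

theorem IsSemiReflexive.exists_BBC_CNC (hr : IsSemiReflexive 𝕜 (gammaTilde 𝕜 τ τt))
    (hτ : IsLCHausdorff 𝕜 τ) (hborn : IsBornological 𝕜 τ) (h : IsLCHausdorff 𝕜 τt)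
    (hp : τt ≤ pointwiseTopology F) (hC : CNC 𝕜 τ τt)
    (hs : SameBounded 𝕜 τ (gammaTilde 𝕜 τ τt)) :
    ∃ τt : TopologicalSpace F, IsLCHausdorff 𝕜 τt ∧ τt ≤ pointwiseTopology F ∧
      BBC 𝕜 τ τt ∧ CNC 𝕜 τ τt := by
  have hγ := (isLeast_gammaTilde (𝕜 := 𝕜) τ τt h).1.1
  have hδ := continuous_pointEval_gammaTilde (𝕜 := 𝕜) (τ := τ) h hp
  let _ : TopologicalSpace F := gammaTilde 𝕜 τ τt
  have ⟨_, _, _, _⟩ := hγ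
  have := barrelledSpace_strongDual hr
  have hT : IsStrongLinearisation F τ (fun x => (⟨pointEval F x, hδ x⟩ : StrongDual 𝕜 F))
      (LinearEquiv.ofBijective (evalBidual 𝕜 F) (bijective_evalBidual hr)) :=
    ⟨isHomeomorph_evalBidual hτ hborn hr hs (hC.mono (gammaTilde_le h)), fun _ => rfl⟩
  exact hT.exists_BBC_CNC

end FunctionSpaces

end LCLin

theorem mainTheorem2 {𝕜 : Type v} [RCLike 𝕜] {Ω : Type u} [Nonempty Ω]
    (F : Submodule 𝕜 (Ω → 𝕜)) (τ : TopologicalSpace F)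
    (hτ : LCLin.IsLCHausdorff 𝕜 τ) (hborn : LCLin.IsBornological 𝕜 τ) :
    List.TFAE [
      LCLin.AdmitsStrongCompleteBarrelledLinearisation.{u, v, w} F τ,
      LCLin.HasSemiMontelPrebidualWithEvaluations.{u, v, w} F τ,
      ∃ τt : TopologicalSpace F, LCLin.IsLCHausdorff 𝕜 τt ∧ τt ≤ LCLin.pointwiseTopology F ∧
        LCLin.BBC 𝕜 τ τt ∧ LCLin.CNC 𝕜 τ τt ∧
        LCLin.SameBounded 𝕜 τ (LCLin.gammaTilde 𝕜 τ τt),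
      ∃ τt : TopologicalSpace F, LCLin.IsLCHausdorff 𝕜 τt ∧ τt ≤ LCLin.pointwiseTopology F ∧
        LCLin.BBCl 𝕜 τ τt ∧ LCLin.CNC 𝕜 τ τt ∧
        LCLin.IsSemiReflexive 𝕜 (LCLin.gammaTilde 𝕜 τ τt) ∧
        LCLin.SameBounded 𝕜 τ (LCLin.gammaTilde 𝕜 τ τt),
      ∃ τt : TopologicalSpace F, LCLin.IsLCHausdorff 𝕜 τt ∧ τt ≤ LCLin.pointwiseTopology F ∧
        LCLin.BBC 𝕜 τ τt ∧ LCLin.CNC 𝕜 τ τt,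
      ∃ τt : TopologicalSpace F, LCLin.IsLCHausdorff 𝕜 τt ∧
        LCLin.BBC 𝕜 τ τt ∧ LCLin.CNC 𝕜 τ τt ∧
        ∀ x : Ω, LCLin.pointEval F x ∈ LCLin.boundedDual 𝕜 τ τt] := by
  tfae_have 1 → 5 := LCLin.AdmitsStrongCompleteBarrelledLinearisation.exists_BBC_CNC
  tfae_have 2 → 1 :=
    LCLin.HasSemiMontelPrebidualWithEvaluations.admitsStrongCompleteBarrelledLinearisation
  tfae_have 3 → 2 := by
    rintro ⟨τt, h, hp, hB, hC, hs⟩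
    exact .of_BBC_CNC hτ hborn h hp hB hC hs
  tfae_have 3 → 4 := by
    rintro ⟨τt, h, hp, hB, hC, hs⟩
    have := h.t2Space
    exact ⟨τt, h, hp, hB.bbcl, hC, hB.isSemiReflexive_gammaTilde h hs, hs⟩
  tfae_have 4 → 5 := by
    rintro ⟨τt, h, hp, -, hC, hr, hs⟩
    exact hr.exists_BBC_CNC hτ hborn h hp hC hs
  tfae_have 5 → 3 := by
    rintro ⟨τt, h, hp, hB, hC⟩
    exact ⟨τt, h, hp, hB, hC, LCLin.sameBounded_gammaTilde hτ h hB hC⟩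
  tfae_have 5 → 6 := by
    rintro ⟨τt, h, hp, hB, hC⟩
    exact ⟨τt, h, hB, hC, LCLin.pointEval_mem_boundedDual hp⟩
  tfae_have 6 → 5 := by
    rintro ⟨τt, h, hB, hC, hδ⟩
    exact ⟨_, h.inf_induced F.subtype, inf_le_right, hB.inf_pointwiseTopology hδ,
      hC.mono inf_le_left⟩
  tfae_finish
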